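/- Let $\mathbb S=\mathbb R$ or $\mathbb S=\mathbb Z$, $\mathbb S_+=\{t\in\mathbb S: t\ge 0\}$, let $Y$ be a complete metric space and $(Y,\mathbb S,\sigma)$ a (continuous) two-sided dynamical system. Let $\varphi:\mathbb S_+\times\mathbb R\times Y\to\mathbb R$ be a cocycle over $\sigma$, i.e. $\varphi$ is continuous, $\varphi(0,u,y)=u$ and $\varphi(t+\tau,u,y)=\varphi(t,\varphi(\tau,u,y),\sigma(\tau,y))$, and let $\pi(t,(u,y))=(\varphi(t,u,y),\sigma(t,y))$ be the skew-product semiflow on $X=\mathbb R\times Y$. Denote by $\omega_x$ the set of $\omega$-limit points of $x$ (limits of the motion along sequences of times tending to $+\infty$). Let $x_0=(u_0,y_0)\in X$ and assume: 1. $x_0$ is positively Lagrange stable for $\pi$, and $y_0$ is positively Lagrange stable for $\sigma$ (their forward trajectories are precompact); 2. $\omega_{y_0}$ is minimal: it is nonempty and $\overline{\{\sigma(t,y):t\in\mathbb S\}}=\omega_{y_0}$ for every $y\in\omega_{y_0}$; 3. $|\varphi(t,u_1,y)-\varphi(t,u_2,y)|\le|u_1-u_2|$ for all $t\in\mathbb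 S_+$, $u_1,u_2\in\mathbb R$, $y\in Y$. Then there are a continuous function $\nu:Y\to\mathbb R$ and a compact set $M\subseteq X$, containing $\omega_{x_0}$ and all the points $(\nu(y),y)$ with $y\in\omega_{y_0}$, such that $\pi$ generates on $M$ a two-sided dynamical system $(M,\mathbb S,\pi)$ (that is, there is a continuous flow of $\mathbb S$ on $M$ which for $t\ge0$ is the restriction of $\pi$). Writing $\varphi(t,v,y)$, for $(v,y)\in M$ and all $t\in\mathbb S$, for the first coordinate of $\pi(t,(v,y))$ in this two-sided system, the following hold: (i) for all $y\in\omega_{y_0}$ and $t\in\mathbb S$, $\pi(t,(\nu(y),y))=(\nu(\sigma(t,y)),\sigma(t,y))$; in particular $\nu(\sigma(t,y))=\varphi(t,\nu(y),y)$; (ii) if $\mathbb S=\mathbb R$, or if the cocycle is monotone ($u_1\le u_2$ implies $\varphi(t,u_1,y)\le\varphi(t,u_2,y)$ for all $t\in\mathbb S_+$, $y\in Y$), then for every $(v,y)\in\omega_{x_0}$ there is a constant $C=C(v,y)\in\mathbb R$ such that $\varphi(t,v,y)=\nu(\sigma(t,y))+C$ for all $t\in\mathbb S$. -/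

import Mathlib

open Set Filter Topology

/-- A one-dimensional cocycle `⟨ℝ, φ, (Y, 𝕊, σ)⟩` over the two-sided flow `σ`: a continuous map
`φ : 𝕊₊ × ℝ × Y → ℝ` with the cocycle identity. The time group `𝕊` is a subgroup `S` of `ℝ`
(it is taken to be `ℝ` or `ℤ` in the theorem), and `𝕊₊` is `AddSubmonoid.nonneg S`. -/
structure ScalarCocycle {S : AddSubgroup ℝ} {Y : Type*} [TopologicalSpace Y] (σ : Flow S Y) where
  toFun : AddSubmonoid.nonneg S → ℝ → Y → ℝ
  map_zero' : ∀ u y, toFun 0 u y = u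
  map_add' : ∀ t τ u y, toFun (t + τ) u y = toFun t (toFun τ u y) (σ τ y)
  cont' : Continuous fun q : AddSubmonoid.nonneg S × ℝ × Y => toFun q.1 q.2.1 q.2.2

namespace ScalarCocycle

variable {S : AddSubgroup ℝ} {Y : Type*} [TopologicalSpace Y] {σ : Flow S Y}

instance : CoeFun (ScalarCocycle σ) fun _ => AddSubmonoid.nonneg S → ℝ → Y → ℝ := ⟨toFun⟩

/-- The skew-product semiflow `π(t, (u, y)) = (φ(t, u, y), σ(t, y))` on `ℝ × Y`. -/
def skewProduct (φ : ScalarCocycle σ) : Flow (AddSubmonoid.nonneg S) (ℝ × Y) where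
  toFun t x := (φ t x.1 x.2, σ t x.2)
  cont' := by
    refine Continuous.prodMk ?_ ?_
    · exact φ.cont'.comp
        (continuous_fst.prodMk (continuous_snd.fst.prodMk continuous_snd.snd))
    · exact σ.continuous (continuous_subtype_val.comp continuous_fst) continuous_snd.snd
  map_add' t τ x := by
    refine Prod.ext (φ.map_add' t τ x.1 x.2) ?_
    exact σ.map_add _ _ _
  map_zero' x := Prod.ext (φ.map_zero' x.1 x.2) (σ.map_zero_apply x.2)

/-- Every fibre map of a monotone cocycle is order preserving. -/
def IsMonotone (φ : ScalarCocycle σ) : Prop :=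
  ∀ u₁ u₂ : ℝ, u₁ ≤ u₂ → ∀ t y, φ t u₁ y ≤ φ t u₂ y

end ScalarCocycle

/-- The set of `ω`-limit points of the point `x`, as time tends to `+∞`. -/
def omegaLimitPt {T X : Type*} [Preorder T] [AddZero T] [TopologicalSpace T] [TopologicalSpace X]
    (π : Flow T X) (x : X) : Set X :=
  omegaLimit atTop π {x}

/-- A nonempty set is minimal if it is the orbit closure of each of its points. -/
def IsMinimalSet {T X : Type*} [AddMonoid T] [TopologicalSpace T] [TopologicalSpace X]
    (σ : Flow T X) (A : Set X) : Prop :=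
  A.Nonempty ∧ ∀ y ∈ A, closure (σ.orbit y) = A

/-- `Φ` is a two-sided dynamical system on `M` generated by the semiflow `π`: for nonnegative
times it is the restriction of `π` to `M` (so `π` maps `M` bijectively to `M`, and `Φ` is the only
such system). -/
def IsTwoSidedExtension {S : AddSubgroup ℝ} {X : Type*} [TopologicalSpace X]
    (π : Flow (AddSubmonoid.nonneg S) X) {M : Set X} (Φ : Flow S M) : Prop :=
  ∀ (t : AddSubmonoid.nonneg S) (x : M), (Φ t x : X) = π t x

open Function

/-! Let `K` and `H` be the ω-limit sets of `x₀` and of its base point, and let `a`, `b` be the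
supremum and infimum of the fibres of `K`. Every point of `K` has preimages in `K` at all times, so
a nonexpansive fibre map must reach both new endpoints from `[b, a]`; hence the width `a - b` does
not increase along the flow. It is also upper semicontinuous, so minimality makes it a constant `d`.
Then `a = b + d` is both upper and lower semicontinuous on `H`, and the midpoint `b + d / 2` is
continuous there; Tietze extends it to `ν`.

A nonexpansive map between intervals of equal length that reaches both endpoints has slope `1` or
`-1`, so it preserves midpoints: the graph of `ν` over `H` is invariant. The region `M` between `b`
and `a` is compact and its time maps are bijective, so the semiflow extends to a flow on it. Under
monotonicity, or for connected time, slope `-1` can occur only when `d = 0`; slope `1` then keeps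
the distance to `ν` constant. -/

/-- The positive part of an element of `S`, as a nonnegative time. -/
def nonnegPosPart {S : AddSubgroup ℝ} (t : S) : AddSubmonoid.nonneg S :=
  ⟨max t 0, AddSubmonoid.mem_nonneg.2 (le_max_right _ _)⟩

theorem continuous_nonnegPosPart {S : AddSubgroup ℝ} : Continuous (nonnegPosPart (S := S)) :=
  (continuous_id.max continuous_const).subtype_mk _

/-! ### Extending an invertible semiflow to negative times -/

/-- A semiflow of the nonnegative times on a compact Hausdorff space, all of whose time maps are
bijective, extends to a two-sided flow. -/
theorem Flow.exists_extension_of_bijective {S : AddSubgroup ℝ} {X : Type*} [TopologicalSpace X]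
    [CompactSpace X] [T2Space X] (π : Flow (AddSubmonoid.nonneg S) X)
    (hπ : ∀ t, Bijective (π t)) :
    ∃ Φ : Flow S X, ∀ (t : AddSubmonoid.nonneg S) (x : X), Φ t x = π t x := by
  let p : S → AddSubmonoid.nonneg S := nonnegPosPart
  have hp : Continuous p := continuous_nonnegPosPart
  have hpt : ∀ t, ((p t : S) : ℝ) - (p (-t) : S) = t := by
    intro t
    have h := max_zero_sub_max_neg_zero_eq_self t
    exact congrArg (Subtype.val : S → ℝ) h
  -- With `t = t⁺ - t⁻`, `F t x` is the solution `z` of `π t⁻ z = π t⁺ x`; by `key`, any other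
  -- splitting `t = a - b` yields the same point.
  choose F hF using fun (t : S) (x : X) => (hπ (p (-t))).2 (π (p t) x)
  have comm : ∀ a b x, π a (π b x) = π b (π a x) := fun a b x => by
    rw [← π.map_add, ← π.map_add, add_comm]
  have key : ∀ (t : S) (a b : AddSubmonoid.nonneg S) (x z : X),
      ((a : S) : ℝ) - (b : S) = t → π b z = π a x → z = F t x := by
    intro t a b x z hab h
    have hsum : a + p (-t) = b + p t := by
      apply Subtype.ext; apply Subtype.ext
      have := hpt t
      push_cast
      linarith
    apply (hπ (b + p (-t))).1
    rw [π.map_add b _ (F t x), hF, ← π.map_add, ← hsum, π.map_add a, comm a, ← h, ← π.map_add,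
      add_comm]
  refine ⟨⟨F, ?_, ?_, ?_⟩, ?_⟩
  -- Compactness supplies a limit `z` of `F` along the ultrafilter; passing to the limit in the
  -- defining equation identifies `z` as the value of `F`.
  · rw [continuous_iff_ultrafilter]
    intro q g hg
    obtain ⟨z, -, hz⟩ := isCompact_univ.ultrafilter_le_nhds (g.map (uncurry F)) (by simp)
    have hz : Tendsto (uncurry F) g (𝓝 z) := hz
    have hg : Tendsto id (g : Filter (S × X)) (𝓝 q) := hg
    have hL : Tendsto (fun r : S × X => π (p (-r.1)) (uncurry F r)) g (𝓝 (π (p (-q.1)) z)) := by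
      have hc : Continuous fun r : (S × X) × X => π (p (-r.1.1)) r.2 := by fun_prop
      exact (hc.tendsto (q, z)).comp (hg.prodMk_nhds hz)
    have hR : Tendsto (fun r : S × X => π (p r.1) r.2) g (𝓝 (π (p q.1) q.2)) := by
      have hc : Continuous fun r : S × X => π (p r.1) r.2 := by fun_prop
      exact (hc.tendsto q).comp hg
    have hLR : (fun r : S × X => π (p (-r.1)) (uncurry F r)) = fun r => π (p r.1) r.2 :=
      funext fun r => hF r.1 r.2
    rw [hLR] at hL
    rw [show uncurry F q = z from
      (key q.1 (p q.1) (p (-q.1)) q.2 z (hpt _) (tendsto_nhds_unique hL hR)).symm]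
    exact hz
  · intro t s x
    symm
    apply key (t + s) (p t + p s) (p (-t) + p (-s))
    · have := hpt t
      have := hpt s
      push_cast
      linarith
    · rw [add_comm, π.map_add, hF, comm, hF, π.map_add]
  · intro x
    symm
    exact key 0 0 0 x x (by simp) rfl
  · intro t x
    symm
    exact key t t 0 x _ (by simp) (by rw [π.map_zero]; rfl)

/-! ### Limit sets of precompact orbits -/

section OmegaLimit

variable {S : AddSubgroup ℝ} {Y : Type*} [TopologicalSpace Y]

theorem tendsto_nonnegPosPart_atTop (S : AddSubgroup ℝ) :
    Tendsto (nonnegPosPart (S := S)) atTop atTop :=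
  tendsto_atTop.2 fun b => (eventually_ge_atTop (b : S)).mono fun _ ht =>
    Subtype.coe_le_coe.1 (ht.trans (le_max_left _ _))

theorem tendsto_nonneg_val_atTop (S : AddSubgroup ℝ) :
    Tendsto (Subtype.val : AddSubmonoid.nonneg S → S) atTop atTop :=
  tendsto_atTop.2 fun b => (eventually_ge_atTop (nonnegPosPart b)).mono fun _ ht =>
    (le_max_left b 0).trans ht

theorem omegaLimitPt_subset_closure_orbit (π : Flow (AddSubmonoid.nonneg S) Y) (x : Y) :
    omegaLimitPt π x ⊆ closure (π.orbit x) := by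
  refine (omegaLimit_subset_closure_image2 atTop π {x} univ_mem).trans (closure_mono ?_)
  rintro _ ⟨t, -, _, rfl, rfl⟩
  exact π.mem_orbit _ t

theorem omegaLimitPt_subset_closure_forwardOrbit (σ : Flow S Y) (y : Y) :
    omegaLimitPt σ y ⊆ closure (σ.forwardOrbit y) := by
  refine (omegaLimit_subset_closure_image2 atTop σ {y} (Ici_mem_atTop 0)).trans (closure_mono ?_)
  rintro _ ⟨t, ht, _, rfl, rfl⟩
  exact ⟨⟨t, ht⟩, rfl⟩

/-- The `ω`-limit set of a point with relatively compact orbit is negatively invariant. -/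
theorem exists_mem_omegaLimitPt_eq [T2Space Y] (π : Flow (AddSubmonoid.nonneg S) Y) {x p : Y}
    (hx : IsCompact (closure (π.orbit x))) (hp : p ∈ omegaLimitPt π x)
    (t : AddSubmonoid.nonneg S) : ∃ q ∈ omegaLimitPt π x, π t q = p := by
  rw [omegaLimitPt, mem_omegaLimit_singleton_iff_mapClusterPt, mapClusterPt_iff_ultrafilter] at hp
  obtain ⟨U, hU, hUp⟩ := hp
  -- The preimage is the limit of the orbit at the times delayed by `t`; truncation at `0` is
  -- harmless since eventually `s ≥ t`.
  let m : AddSubmonoid.nonneg S → AddSubmonoid.nonneg S := fun s => nonnegPosPart ((s : S) - t)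
  have hm : Tendsto m atTop atTop := tendsto_atTop.2 fun b =>
    (eventually_ge_atTop (b + t)).mono fun s hs => by
      have hs' : (b : S) + t ≤ s := hs
      exact Subtype.coe_le_coe.1 ((le_sub_iff_add_le.2 hs').trans (le_max_left _ _))
  obtain ⟨q, -, hq⟩ := hx.ultrafilter_le_nhds (U.map fun s => π (m s) x)
    (tendsto_principal.2 (Eventually.of_forall fun s => subset_closure (π.mem_orbit _ _)))
  have hq : Tendsto (fun s => π (m s) x) U (𝓝 q) := hq
  refine ⟨q, ?_, ?_⟩
  · rw [omegaLimitPt, mem_omegaLimit_singleton_iff_mapClusterPt, mapClusterPt_iff_ultrafilter]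
    exact ⟨U.map m, (hm.mono_left hU), hq⟩
  · refine tendsto_nhds_unique (((π.continuous_toFun t).tendsto q).comp hq) (hUp.congr' ?_)
    filter_upwards [hU (eventually_ge_atTop t)] with s hs
    have hs' : (t : S) ≤ s := hs
    have : s = t + m s := by
      apply Subtype.ext
      change (s : S) = t + max ((s : S) - t) 0
      rw [max_eq_left (sub_nonneg.2 hs')]
      abel
    simp only [comp_apply]
    rw [← π.map_add, ← this]

theorem isInvariant_omegaLimitPt (σ : Flow S Y) (y : Y) :
    IsInvariant σ (omegaLimitPt σ y) :=
  σ.isInvariant_omegaLimit atTop {y} fun t => tendsto_atTop_add_const_left _ t tendsto_id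

end OmegaLimit

/-! ### Rigidity from minimality and nonexpansiveness -/

/-- A function that is upper semicontinuous on a compact minimal set and nonincreasing along the
flow is constant on it. -/
theorem IsMinimalSet.le_of_upperSemicontinuousOn {S : AddSubgroup ℝ} {Y : Type*}
    [TopologicalSpace Y] {σ : Flow S Y} {H : Set Y} (hH : IsMinimalSet σ H) (hc : IsCompact H)
    (hinv : IsInvariant σ H) {D : Y → ℝ} (hD : UpperSemicontinuousOn D H)
    (hmono : ∀ y ∈ H, ∀ t : S, 0 ≤ t → D (σ t y) ≤ D y) {y z : Y} (hy : y ∈ H) (hz : z ∈ H) :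
    D y ≤ D z := by
  refine le_of_forall_gt fun c hzc => ?_
  obtain ⟨U, hU, hUD⟩ := mem_nhdsWithin.1 (hD z hz c hzc)
  have hcov : H ⊆ ⋃ s : S, σ s ⁻¹' U := by
    intro w hw
    have : z ∈ closure (σ.orbit w) := by rwa [hH.2 w hw]
    obtain ⟨_, hv, s, rfl⟩ := mem_closure_iff.1 this U hU hUD.1
    exact mem_iUnion.2 ⟨s, hv⟩
  obtain ⟨F, hF⟩ := hc.elim_finite_subcover _ (fun s => hU.preimage (σ.continuous_toFun s)) hcov
  -- Start at `σ (-m) y`, with `m` bounding the finitely many times: the orbit enters `{D < c}` at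
  -- some `s ≤ m`, and monotonicity carries `D < c` on to time `m`, which is `y`.
  obtain ⟨m, hm⟩ := F.exists_le
  obtain ⟨s, hs, hsU⟩ := mem_iUnion₂.1 (hF (hinv (-m) hy))
  have hsH : σ s (σ (-m) y) ∈ H := hinv s (hinv (-m) hy)
  have hle := hmono _ hsH (m - s) (sub_nonneg.2 (hm s hs))
  rw [← σ.map_add, ← σ.map_add, show m - s + s + -m = 0 by abel, σ.map_zero_apply] at hle
  exact hle.trans_lt (hUD.2 ⟨hsU, hsH⟩)

/-- A nonexpansive map between intervals of equal length attaining both endpoints is an isometry of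
slope `1` or `-1`. -/
theorem eq_add_or_eq_sub_of_nonexpansive {f : ℝ → ℝ} (hf : ∀ u v, |f u - f v| ≤ |u - v|)
    {b a b' a' : ℝ} (hlen : a' - b' = a - b) {u v : ℝ} (hu : u ∈ Icc b a) (hv : v ∈ Icc b a)
    (hfu : f u = a') (hfv : f v = b') :
    (∀ w ∈ Icc b a, f w = b' + (w - b)) ∨ ∀ w ∈ Icc b a, f w = a' - (w - b) := by
  have huv := hf u v
  rw [hfu, hfv, hlen, abs_of_nonneg (by linarith [hu.1, hu.2])] at huv
  -- The length of `[b, a]` is at most `|u - v|`, so `u` and `v` are opposite endpoints, and the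
  -- bounds from both ends pin down `f w`.
  rcases le_abs.1 huv with h | h
  · left
    intro w hw
    have h1 := hf w u
    have h2 := hf w v
    rw [hfu, abs_sub_comm w, abs_of_nonneg (by linarith [hw.2, hv.1] : 0 ≤ u - w)] at h1
    rw [hfv, abs_of_nonneg (by linarith [hw.1, hu.2] : 0 ≤ w - v)] at h2
    have h1 := abs_le.1 h1
    have h2 := abs_le.1 h2
    linarith [hu.1, hu.2, hv.1, hv.2]
  · right
    intro w hw
    have h1 := hf w u
    have h2 := hf w v
    rw [hfu, abs_of_nonneg (by linarith [hw.1, hv.2] : 0 ≤ w - u)] at h1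
    rw [hfv, abs_sub_comm w, abs_of_nonneg (by linarith [hw.2, hu.1] : 0 ≤ v - w)] at h2
    have h1 := abs_le.1 h1
    have h2 := abs_le.1 h2
    linarith [hu.1, hu.2, hv.1, hv.2]

/-! ### Fibres of compact sets -/

section Fibre

variable {Y : Type*} [TopologicalSpace Y]

/-- The fibre over `y` of a subset of `ℝ × Y`. -/
def fibre (K : Set (ℝ × Y)) (y : Y) : Set ℝ := {u | (u, y) ∈ K}

theorem isCompact_fibre {K : Set (ℝ × Y)} [T2Space Y] (hK : IsCompact K) (y : Y) :
    IsCompact (fibre K y) := by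
  have : fibre K y = Prod.fst '' (K ∩ Prod.snd ⁻¹' {y}) := by
    ext u
    simp [fibre]
  rw [this]
  exact (hK.inter_right (isClosed_singleton.preimage continuous_snd)).image continuous_fst

/-- The base points whose fibre meets `[c, ∞)` form the projection of a compact set, hence a closed
set. -/
theorem upperSemicontinuousOn_sSup_fibre [T2Space Y] {K : Set (ℝ × Y)} (hK : IsCompact K)
    {H : Set Y} (hH : ∀ y ∈ H, (fibre K y).Nonempty) :
    UpperSemicontinuousOn (fun y => sSup (fibre K y)) H := by
  intro y hy c hc
  have hcl : IsClosed (Prod.snd '' (K ∩ Prod.fst ⁻¹' Ici c)) :=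
    ((hK.inter_right (isClosed_Ici.preimage continuous_fst)).image continuous_snd).isClosed
  have hyc : y ∈ (Prod.snd '' (K ∩ Prod.fst ⁻¹' Ici c))ᶜ := by
    rintro ⟨⟨u, _⟩, ⟨hu, huc⟩, rfl⟩
    exact (hc.trans_le huc).not_ge (le_csSup (isCompact_fibre hK _).bddAbove hu)
  filter_upwards [self_mem_nhdsWithin, mem_nhdsWithin_of_mem_nhds (hcl.isOpen_compl.mem_nhds hyc)]
    with z hz hzc
  by_contra! h
  exact hzc ⟨_, ⟨(isCompact_fibre hK z).sSup_mem (hH z hz), h⟩, rfl⟩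

theorem lowerSemicontinuousOn_sInf_fibre [T2Space Y] {K : Set (ℝ × Y)} (hK : IsCompact K)
    {H : Set Y} (hH : ∀ y ∈ H, (fibre K y).Nonempty) :
    LowerSemicontinuousOn (fun y => sInf (fibre K y)) H := by
  intro y hy c hc
  have hcl : IsClosed (Prod.snd '' (K ∩ Prod.fst ⁻¹' Iic c)) :=
    ((hK.inter_right (isClosed_Iic.preimage continuous_fst)).image continuous_snd).isClosed
  have hyc : y ∈ (Prod.snd '' (K ∩ Prod.fst ⁻¹' Iic c))ᶜ := by
    rintro ⟨⟨u, _⟩, ⟨hu, huc⟩, rfl⟩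
    exact (lt_of_le_of_lt huc hc).not_ge (csInf_le (isCompact_fibre hK _).bddBelow hu)
  filter_upwards [self_mem_nhdsWithin, mem_nhdsWithin_of_mem_nhds (hcl.isOpen_compl.mem_nhds hyc)]
    with z hz hzc
  by_contra! h
  exact hzc ⟨_, ⟨(isCompact_fibre hK z).sInf_mem (hH z hz), h⟩, rfl⟩

/-- The region over `H` between the graphs of two functions continuous on the compact set `H` is
compact. -/
theorem isCompact_region_between {H : Set Y} (hH : IsCompact H) {b a : Y → ℝ} {d : ℝ}
    (hb : ContinuousOn b H) (hd : ∀ y ∈ H, a y = b y + d) :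
    IsCompact {x : ℝ × Y | x.2 ∈ H ∧ x.1 ∈ Icc (b x.2) (a x.2)} := by
  have : {x : ℝ × Y | x.2 ∈ H ∧ x.1 ∈ Icc (b x.2) (a x.2)} =
      (fun q : ℝ × Y => (b q.2 + q.1, q.2)) '' (Icc 0 d ×ˢ H) := by
    ext ⟨u, y⟩
    simp only [mem_ofPred_eq, mem_image, mem_prod, Prod.exists, Prod.mk.injEq]
    constructor
    · rintro ⟨hy, h1, h2⟩
      rw [hd y hy] at h2
      exact ⟨u - b y, y, ⟨⟨by linarith, by linarith⟩, hy⟩, by ring, rfl⟩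
    · rintro ⟨s, z, ⟨⟨h1, h2⟩, hz⟩, rfl, rfl⟩
      exact ⟨hz, by linarith, by linarith [hd z hz]⟩
  rw [this]
  refine (isCompact_Icc.prod hH).image_of_continuousOn (ContinuousOn.prodMk ?_ continuousOn_snd)
  exact (hb.comp continuousOn_snd fun q hq => hq.2).add continuousOn_fst

end Fibre

theorem snd_mem_omegaLimitPt {S : AddSubgroup ℝ} {Y : Type*} [TopologicalSpace Y] {σ : Flow S Y}
    (φ : ScalarCocycle σ) {x p : ℝ × Y} (hp : p ∈ omegaLimitPt φ.skewProduct x) :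
    p.2 ∈ omegaLimitPt σ x.2 := by
  rw [omegaLimitPt, mem_omegaLimit_singleton_iff_mapClusterPt, mapClusterPt_iff_ultrafilter] at hp ⊢
  obtain ⟨U, hU, hUp⟩ := hp
  exact ⟨U.map Subtype.val, (tendsto_nonneg_val_atTop S).mono_left hU,
    (continuous_snd.tendsto p).comp hUp⟩

/-- An ultrafilter of times driving the base orbit to `y` also makes the precompact orbit of `x`
converge, and its limit lies over `y`. -/
theorem exists_mem_omegaLimitPt_skewProduct {S : AddSubgroup ℝ} {Y : Type*} [TopologicalSpace Y]
    [T2Space Y] {σ : Flow S Y} (φ : ScalarCocycle σ) {x : ℝ × Y}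
    (hx : IsCompact (closure (φ.skewProduct.orbit x))) {y : Y} (hy : y ∈ omegaLimitPt σ x.2) :
    (fibre (omegaLimitPt φ.skewProduct x) y).Nonempty := by
  rw [omegaLimitPt, mem_omegaLimit_singleton_iff_mapClusterPt, mapClusterPt_iff_ultrafilter] at hy
  obtain ⟨U, hU, hUy⟩ := hy
  obtain ⟨q, -, hq⟩ := hx.ultrafilter_le_nhds (U.map fun s => φ.skewProduct (nonnegPosPart s) x)
    (tendsto_principal.2 (Eventually.of_forall fun s =>
      subset_closure (φ.skewProduct.mem_orbit _ _)))
  have hq : Tendsto (fun s => φ.skewProduct (nonnegPosPart s) x) U (𝓝 q) := hq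
  have hqy : q.2 = y := by
    refine tendsto_nhds_unique ((continuous_snd.tendsto q).comp hq) (hUy.congr' ?_)
    filter_upwards [hU (eventually_ge_atTop 0)] with s hs
    have : ((nonnegPosPart s : AddSubmonoid.nonneg S) : S) = s := max_eq_left hs
    change σ s x.2 = σ (nonnegPosPart s : AddSubmonoid.nonneg S) x.2
    rw [this]
  refine ⟨q.1, ?_⟩
  subst hqy
  change q ∈ omegaLimitPt φ.skewProduct x
  rw [omegaLimitPt, mem_omegaLimit_singleton_iff_mapClusterPt, mapClusterPt_iff_ultrafilter]
  exact ⟨U.map nonnegPosPart, (tendsto_nonnegPosPart_atTop S).mono_left hU, hq⟩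

/-- A continuous function on the nonnegative reals of constant absolute value which is
nonnegative at `0` is constant. -/
theorem eq_of_abs_eq_of_continuous {g : AddSubmonoid.nonneg (⊤ : AddSubgroup ℝ) → ℝ}
    (hg : Continuous g) {r : ℝ} (habs : ∀ t, |g t| = r) (h0 : 0 ≤ g 0)
    (t : AddSubmonoid.nonneg (⊤ : AddSubgroup ℝ)) : g t = r := by
  by_contra hne
  have hr : g t = -r := by
    rcases abs_eq (habs t ▸ abs_nonneg _) |>.1 (habs t) with h | h
    exacts [absurd h hne, h]
  have hg0 : g 0 = r := by rw [← habs 0, abs_of_nonneg h0]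
  have hrpos : 0 < r := lt_of_le_of_ne (hg0 ▸ h0) fun h => hne (by rw [hr, ← h, neg_zero])
  let e : ℝ → AddSubmonoid.nonneg (⊤ : AddSubgroup ℝ) := fun s =>
    nonnegPosPart ⟨s, AddSubgroup.mem_top s⟩
  have he : Continuous e := continuous_nonnegPosPart.comp (continuous_id.subtype_mk _)
  have he0 : e 0 = 0 := Subtype.ext (max_self _)
  have het : e ((t : (⊤ : AddSubgroup ℝ)) : ℝ) = t := Subtype.ext (max_eq_left t.2)
  obtain ⟨s, hs⟩ := mem_range_of_exists_le_of_exists_ge (c := 0) (hg.comp he)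
    ⟨((t : (⊤ : AddSubgroup ℝ)) : ℝ), by simp only [comp_apply, het, hr]; linarith⟩
    ⟨0, by simp only [comp_apply, he0, hg0]; linarith⟩
  have := habs (e s)
  rw [show g (e s) = 0 from hs, abs_zero] at this
  exact hrpos.ne this

/-! ### The main theorem -/

theorem mainTheorem4 (S : AddSubgroup ℝ) (hS : S = ⊤ ∨ S = AddSubgroup.zmultiples (1 : ℝ))
    {Y : Type*} [MetricSpace Y] [CompleteSpace Y] (σ : Flow S Y) (φ : ScalarCocycle σ)
    (x₀ : ℝ × Y)
    (hx₀ : IsCompact (closure (φ.skewProduct.orbit x₀)))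
    (hy₀ : IsCompact (closure (σ.forwardOrbit x₀.2)))
    (hmin : IsMinimalSet σ (omegaLimitPt σ x₀.2))
    (hcontr : ∀ (t : AddSubmonoid.nonneg S) (u₁ u₂ : ℝ) (y : Y),
      |φ t u₁ y - φ t u₂ y| ≤ |u₁ - u₂|) :
    ∃ ν : Y → ℝ, Continuous ν ∧
      ∃ (M : Set (ℝ × Y)) (Φ : Flow S M),
        IsCompact M ∧ IsTwoSidedExtension φ.skewProduct Φ ∧
        (∀ y ∈ omegaLimitPt σ x₀.2, ∃ hM : (ν y, y) ∈ M, ∀ t : S,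
          (Φ t ⟨(ν y, y), hM⟩ : ℝ × Y) = (ν (σ t y), σ t y)) ∧
        ∃ hω : omegaLimitPt φ.skewProduct x₀ ⊆ M,
          (S = ⊤ ∨ φ.IsMonotone) →
            ∀ (v : ℝ) (y : Y) (hx : (v, y) ∈ omegaLimitPt φ.skewProduct x₀),
              ∃ C : ℝ, ∀ t : S, (Φ t ⟨(v, y), hω hx⟩ : ℝ × Y).1 = ν (σ t y) + C := by
  set K := omegaLimitPt φ.skewProduct x₀
  set H := omegaLimitPt σ x₀.2
  have hK : IsCompact K := hx₀.of_isClosed_subset (isClosed_omegaLimit _ _ _)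
    (omegaLimitPt_subset_closure_orbit _ _)
  have hH : IsCompact H := hy₀.of_isClosed_subset (isClosed_omegaLimit _ _ _)
    (omegaLimitPt_subset_closure_forwardOrbit _ _)
  have hHinv : IsInvariant σ H := isInvariant_omegaLimitPt σ _
  have hne : ∀ y ∈ H, (fibre K y).Nonempty := fun y hy =>
    exists_mem_omegaLimitPt_skewProduct φ hx₀ hy
  have hσ : ∀ (t : S) (y : Y), σ t (σ (-t) y) = y := fun t y => by
    rw [← σ.map_add, add_neg_cancel, σ.map_zero_apply]
  have hσ' : ∀ (t : S) (y : Y), σ (-t) (σ t y) = y := fun t y => by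
    rw [← σ.map_add, neg_add_cancel, σ.map_zero_apply]
  -- Off `H` the fibres are empty and both functions take the default value `0`; only their values
  -- over `H` matter.
  let a : Y → ℝ := fun y => sSup (fibre K y)
  let b : Y → ℝ := fun y => sInf (fibre K y)
  have hKab : ∀ u y, (u, y) ∈ K → u ∈ Icc (b y) (a y) := fun u y hu =>
    ⟨csInf_le (isCompact_fibre hK y).bddBelow hu, le_csSup (isCompact_fibre hK y).bddAbove hu⟩
  have hsurj : ∀ (t : AddSubmonoid.nonneg S) (y : Y) (u : ℝ), u ∈ fibre K (σ t y) →
      ∃ w ∈ Icc (b y) (a y), φ t w y = u := by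
    intro t y u hu
    obtain ⟨⟨w, z⟩, hwz, hq⟩ := exists_mem_omegaLimitPt_eq φ.skewProduct hx₀ hu t
    have hz : σ t z = σ t y := congrArg Prod.snd hq
    have hzy : z = y := by rw [← hσ' t z, hz, hσ']
    subst hzy
    exact ⟨w, hKab _ _ hwz, congrArg Prod.fst hq⟩
  have hatt : ∀ y ∈ H, ∀ t : AddSubmonoid.nonneg S,
      (∃ w ∈ Icc (b y) (a y), φ t w y = a (σ t y)) ∧
        ∃ w ∈ Icc (b y) (a y), φ t w y = b (σ t y) := fun y hy t =>
    ⟨hsurj t y _ ((isCompact_fibre hK _).sSup_mem (hne _ (hHinv t hy))),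
      hsurj t y _ ((isCompact_fibre hK _).sInf_mem (hne _ (hHinv t hy)))⟩
  have hause : UpperSemicontinuousOn a H := upperSemicontinuousOn_sSup_fibre hK hne
  have hblsc : LowerSemicontinuousOn b H := lowerSemicontinuousOn_sInf_fibre hK hne
  have hnegb : UpperSemicontinuousOn (fun y => -b y) H := fun y hy c hc =>
    (hblsc y hy (-c) (neg_lt.1 hc)).mono fun z hz => neg_lt.1 hz
  have hconst : ∀ y ∈ H, ∀ z ∈ H, a y + -b y ≤ a z + -b z := by
    intro y hy z hz
    refine hmin.le_of_upperSemicontinuousOn hH hHinv (D := fun y => a y + -b y)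
      (hause.add hnegb) ?_ hy hz
    intro y hy t ht
    obtain ⟨⟨u, hu, hua⟩, v, hv, hvb⟩ := hatt y hy ⟨t, AddSubmonoid.mem_nonneg.2 ht⟩
    have h1 := (le_abs_self _).trans (hcontr ⟨t, AddSubmonoid.mem_nonneg.2 ht⟩ u v y)
    rw [hua, hvb] at h1
    have h2 : |u - v| ≤ a y - b y := abs_sub_le_iff.2
      ⟨by linarith [hu.2, hv.1], by linarith [hv.2, hu.1]⟩
    change a (σ t y) + -b (σ t y) ≤ a y + -b y
    change a (σ t y) - b (σ t y) ≤ _ at h1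
    linarith
  obtain ⟨y₁, hy₁⟩ := hmin.1
  obtain ⟨d, hd⟩ : ∃ d, ∀ y ∈ H, a y = b y + d :=
    ⟨a y₁ - b y₁, fun y hy => by linarith [hconst y hy y₁ hy₁, hconst y₁ hy₁ y hy]⟩
  have hd0 : 0 ≤ d := by
    obtain ⟨u, hu⟩ := hne y₁ hy₁
    have := hKab u y₁ hu
    linarith [this.1, this.2, hd y₁ hy₁]
  have hbc : ContinuousOn b H := by
    refine continuousOn_iff_lower_upperSemicontinuousOn.2 ⟨hblsc, fun y hy c hc => ?_⟩
    -- Upper semicontinuity of `b` is that of `a = b + d`, shifted by `d`.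
    filter_upwards [hause y hy (c + d) ((hd y hy).trans_lt (add_lt_add_left hc d)), self_mem_nhdsWithin] with z hz hzH
    have := hd z hzH
    exact lt_of_add_lt_add_right (this ▸ hz)
  obtain ⟨g, hg⟩ := ContinuousMap.exists_restrict_eq hH.isClosed
    (⟨H.domRestrict fun y => b y + d / 2, (hbc.add continuousOn_const).domRestrict⟩ : C(H, ℝ))
  have hν : ∀ y ∈ H, g y = b y + d / 2 := fun y hy => DFunLike.congr_fun hg ⟨y, hy⟩
  have hiso : ∀ y ∈ H, ∀ t : AddSubmonoid.nonneg S,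
      (∀ w ∈ Icc (b y) (a y), φ t w y = g (σ t y) + (w - g y)) ∨
        ∀ w ∈ Icc (b y) (a y), φ t w y = g (σ t y) - (w - g y) := by
    intro y hy t
    obtain ⟨⟨u, hu, hua⟩, v, hv, hvb⟩ := hatt y hy t
    have hty := hHinv t hy
    have hy1 := hd y hy
    have hy2 := hd _ hty
    have hy3 := hν y hy
    have hy4 := hν _ hty
    refine (eq_add_or_eq_sub_of_nonexpansive (f := fun w => φ t w y)
      (fun u v => hcontr t u v y) (by linarith) hu hv hua hvb).imp ?_ ?_ <;>
    · intro h w hw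
      have := h w hw
      linarith
  let M : Set (ℝ × Y) := {x | x.2 ∈ H ∧ x.1 ∈ Icc (b x.2) (a x.2)}
  have hM : IsCompact M := isCompact_region_between hH hbc hd
  have hMinv : IsInvariant φ.skewProduct M := by
    rintro t ⟨u, y⟩ ⟨hy, hu⟩
    have hty := hHinv t hy
    refine ⟨hty, ?_⟩
    change φ t u y ∈ Icc (b (σ t y)) (a (σ t y))
    have hy1 := hd y hy
    have hy2 := hd _ hty
    have hy3 := hν y hy
    have hy4 := hν _ hty
    have hu1 := hu.1
    have hu2 := hu.2
    simp only at hu1 hu2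
    rcases hiso y hy t with h | h <;> rw [h u hu] <;> constructor <;> linarith
  have hbij : ∀ t, Bijective (φ.skewProduct.restrict hMinv t) := by
    intro t
    constructor
    · rintro ⟨⟨u, y⟩, hy, hu⟩ ⟨⟨v, z⟩, hz, hv⟩ huv
      have huv' := congrArg Subtype.val huv
      have h2 : σ t y = σ t z := congrArg Prod.snd huv'
      have hyz : y = z := by rw [← hσ' t y, h2, hσ']
      subst hyz
      have h1 : φ t u y = φ t v y := congrArg Prod.fst huv'
      have : u = v := by
        rcases hiso y hy t with h | h <;> rw [h u hu, h v hv] at h1 <;> linarith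
      subst this
      rfl
    · rintro ⟨⟨v, z⟩, hz, hv⟩
      have hy := hHinv (-(t : S)) hz
      have hzt : z = σ t (σ (-(t : S)) z) := (hσ _ _).symm
      generalize σ (-(t : S)) z = y at hy hzt
      subst hzt
      have hy1 := hd y hy
      have hy2 := hd _ hz
      have hy3 := hν y hy
      have hy4 := hν _ hz
      have hv1 := hv.1
      have hv2 := hv.2
      simp only at hv1 hv2 hy2 hy4
      rcases hiso y hy t with h | h
      · have hw : v - g (σ t y) + g y ∈ Icc (b y) (a y) := ⟨by linarith, by linarith⟩
        refine ⟨⟨(_, y), hy, hw⟩, Subtype.ext (Prod.ext ?_ rfl)⟩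
        exact (h _ hw).trans (by ring)
      · have hw : g (σ t y) - v + g y ∈ Icc (b y) (a y) := ⟨by linarith, by linarith⟩
        refine ⟨⟨(_, y), hy, hw⟩, Subtype.ext (Prod.ext ?_ rfl)⟩
        exact (h _ hw).trans (by ring)
  have hνM : ∀ y ∈ H, (g y, y) ∈ M := fun y hy => by
    have hy1 := hd y hy
    have hy3 := hν y hy
    exact ⟨hy, by simp only; linarith, by simp only; linarith⟩
  have : CompactSpace M := isCompact_iff_compactSpace.1 hM
  obtain ⟨Φ, hΦ⟩ := Flow.exists_extension_of_bijective (φ.skewProduct.restrict hMinv) hbij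
  have hext : IsTwoSidedExtension φ.skewProduct Φ := fun t x => congrArg Subtype.val (hΦ t x)
  have hΦinv : ∀ (t : S) (x : M), Φ (-t) (Φ t x) = x := fun t x => by
    rw [← Φ.map_add, neg_add_cancel, Φ.map_zero_apply]
  have hΦsnd : ∀ (t : S) (x : M), (Φ t x : ℝ × Y).2 = σ t (x : ℝ × Y).2 := by
    intro t x
    rcases le_total 0 t with ht | ht
    · exact congrArg Prod.snd (hext ⟨t, AddSubmonoid.mem_nonneg.2 ht⟩ x)
    · have h := congrArg Prod.snd (hext ⟨-t, AddSubmonoid.mem_nonneg.2 (neg_nonneg.2 ht)⟩ (Φ t x))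
      change (Φ (-t) (Φ t x) : ℝ × Y).2 = σ (-t) (Φ t x : ℝ × Y).2 at h
      rw [hΦinv] at h
      rw [h, hσ]
  have hgraph : ∀ y (hy : y ∈ H) (t : S), 0 ≤ t →
      (Φ t ⟨(g y, y), hνM y hy⟩ : ℝ × Y) = (g (σ t y), σ t y) := by
    intro y hy t ht
    rw [hext ⟨t, AddSubmonoid.mem_nonneg.2 ht⟩]
    refine Prod.ext ?_ rfl
    rcases hiso y hy ⟨t, AddSubmonoid.mem_nonneg.2 ht⟩ with h | h
    · exact (h _ (hνM y hy).2).trans (by simp)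
    · exact (h _ (hνM y hy).2).trans (by simp)
  refine ⟨g, g.continuous, M, Φ, hM, hext, fun y hy => ⟨hνM y hy, fun t => ?_⟩,
    fun x hx => ⟨snd_mem_omegaLimitPt φ hx, hKab x.1 x.2 hx⟩, fun hor v y hx => ?_⟩
  · rcases le_total 0 t with ht | ht
    · exact hgraph y hy t ht
    · have h := hgraph (σ t y) (hHinv t hy) (-t) (neg_nonneg.2 ht)
      rw [hσ'] at h
      have h' : Φ (-t) ⟨(g (σ t y), σ t y), hνM _ (hHinv t hy)⟩ = ⟨(g y, y), hνM y hy⟩ :=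
        Subtype.ext h
      rw [← h', ← Φ.map_add, add_neg_cancel, Φ.map_zero_apply]
  · have hplus : ∀ y ∈ H, ∀ (t : AddSubmonoid.nonneg S), ∀ w ∈ Icc (b y) (a y),
        φ t w y = g (σ t y) + (w - g y) := by
      intro y hy t
      have hty := hHinv t hy
      have hy1 := hd y hy
      have hy3 := hν y hy
      have ha : a y ∈ Icc (b y) (a y) := ⟨by linarith, le_rfl⟩
      have hb : b y ∈ Icc (b y) (a y) := ⟨le_rfl, by linarith⟩
      rcases hiso y hy t with h | h
      · exact h
      -- A reversing fibre map forces zero width, and then both slopes agree on the one-point fibre.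
      · have hd0' : d = 0 := by
          refine le_antisymm ?_ hd0
          rcases hor with rfl | hmono
          -- The deviation of the upper endpoint from `ν` has constant modulus `d / 2` and starts at
          -- `d / 2`; by continuity in time it cannot change sign, yet reversal would make it `-(d /
          -- 2)`.
          · have hcont : Continuous fun s : AddSubmonoid.nonneg (⊤ : AddSubgroup ℝ) =>
                φ s (a y) y - g (σ s y) := by
              refine Continuous.sub ?_ (g.continuous.comp
                (σ.continuous continuous_subtype_val continuous_const))
              exact φ.cont'.comp (continuous_id.prodMk (continuous_const (y := (a y, y))))
            have := eq_of_abs_eq_of_continuous hcont (r := d / 2) (fun s => ?_) ?_ t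
            · rw [h _ ha] at this
              linarith
            · rcases hiso y hy s with h | h <;> rw [h _ ha]
              · rw [show g (σ s y) + (a y - g y) - g (σ s y) = d / 2 by linarith,
                  abs_of_nonneg (by linarith)]
              · rw [show g (σ s y) - (a y - g y) - g (σ s y) = -(d / 2) by linarith, abs_neg,
                  abs_of_nonneg (by linarith)]
            · have h0 : φ 0 (a y) y = a y := φ.map_zero' _ _
              have h0' : σ ((0 : AddSubmonoid.nonneg (⊤ : AddSubgroup ℝ)) : (⊤ : AddSubgroup ℝ)) y
                = y := σ.map_zero_apply y
              rw [h0, h0']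
              linarith
          -- Reversal swaps the endpoints, so order preservation gives `d ≤ 0`.
          · have := hmono (b y) (a y) hb.2 t y
            rw [h _ ha, h _ hb] at this
            linarith
        intro w hw
        have hwg : w = g y := by linarith [hw.1, hw.2]
        rw [h w hw, hwg]
        ring
    refine ⟨v - g y, fun t => ?_⟩
    have hyH : y ∈ H := snd_mem_omegaLimitPt φ hx
    rcases le_total 0 t with ht | ht
    · rw [hext ⟨t, AddSubmonoid.mem_nonneg.2 ht⟩]
      exact hplus y hyH ⟨t, AddSubmonoid.mem_nonneg.2 ht⟩ v (hKab v y hx)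
    -- For negative `t`, apply the forward law for time `-t` to the point reached at time `t`.
    · have hsnd := hΦsnd t ⟨(v, y), ⟨hyH, hKab v y hx⟩⟩
      have hinv := congrArg Subtype.val (hΦinv t ⟨(v, y), ⟨hyH, hKab v y hx⟩⟩)
      generalize Φ t ⟨(v, y), ⟨hyH, hKab v y hx⟩⟩ = q at hsnd hinv
      obtain ⟨⟨w, z⟩, hz, hw⟩ := q
      rw [hext ⟨-t, AddSubmonoid.mem_nonneg.2 (neg_nonneg.2 ht)⟩] at hinv
      have h1 := congrArg Prod.fst hinv
      have h2 := hplus z hz ⟨-t, AddSubmonoid.mem_nonneg.2 (neg_nonneg.2 ht)⟩ w hw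
      change φ ⟨-t, _⟩ w z = v at h1
      change z = σ t y at hsnd
      rw [h1] at h2
      subst hsnd
      change v = g (σ (-t) (σ t y)) + _ at h2
      rw [hσ'] at h2
      change w = _
      linarith
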